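/- **Theorem (volume of $K^\lambda$ for $0<\lambda<1$).** Let $K\subset\mathbb R^n$ be a compact convex set with $0$ in its interior, with radial function $r_K(\theta)=\sup\{t\ge 0: t\theta\in K\}$, $\theta\in S^{n-1}$. For $s>0$ let $S_s(K)$ be the star body with radial function $r_K^s$, that is, $S_s(K)=\{0\}\cup\{t\theta:\theta\in S^{n-1},\ 0< t\le r_K(\theta)^s\}$, and let $P_s(K)=\operatorname{conv}S_s(K)$. Let $0<\lambda<1$. For a partition $\Pi:\ \lambda=t_0<t_1<\dots<t_m=1$ of $[\lambda,1]$ put $s_i=t_{i-1}/t_i$ and $$P_\Pi(K)=\left(P_{s_1}\circ P_{s_2}\circ\dots\circ P_{s_m}\right)(K),$$ and define $$K^\lambda=\overline{\bigcup_\Pi P_\Pi(K)},$$ the union being over all partitions $\Pi$ of $[\lambda,1]$. Then $$|K^\lambda|\le |B_2^n|^{1-\lambda}\,|K|^\lambda,$$ where $|\cdot|$ denotes volume and $B_2^n$ is the Euclidean unit ball. -/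

import Mathlib

open MeasureTheory Set

noncomputable section

/-- The radial function `r_K(θ) = sup {t ≥ 0 : t θ ∈ K}` of a set `K` (used for `|θ| = 1`). -/
def radialFun {n : ℕ} (K : Set (EuclideanSpace ℝ (Fin n))) (θ : EuclideanSpace ℝ (Fin n)) : ℝ :=
  sSup {t : ℝ | 0 ≤ t ∧ t • θ ∈ K}

/-- The star body with radial function `ρ`: the origin together with all `x = t θ`, where
`|θ| = 1` and `0 < t ≤ ρ(θ)`. -/
def starBody {n : ℕ} (ρ : EuclideanSpace ℝ (Fin n) → ℝ) : Set (EuclideanSpace ℝ (Fin n)) :=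
  {x | x = 0 ∨ ‖x‖ ≤ ρ (‖x‖⁻¹ • x)}

/-- The star body `S_s(K)`, whose radial function is `r_K ^ s`. -/
def starPower {n : ℕ} (s : ℝ) (K : Set (EuclideanSpace ℝ (Fin n))) :
    Set (EuclideanSpace ℝ (Fin n)) :=
  starBody fun θ => radialFun K θ ^ s

/-- The naive power `P_s(K) = conv S_s(K)`. -/
def naivePower {n : ℕ} (s : ℝ) (K : Set (EuclideanSpace ℝ (Fin n))) :
    Set (EuclideanSpace ℝ (Fin n)) :=
  convexHull ℝ (starPower s K)

/-- `t 0 < t 1 < ⋯ < t m` is a partition of the interval `[a, b]`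
(the values of `t` beyond `m` are irrelevant). -/
def IsPartition (a b : ℝ) (m : ℕ) (t : ℕ → ℝ) : Prop :=
  t 0 = a ∧ t m = b ∧ ∀ i < m, t i < t (i + 1)

/-- `P_Π(K) = (P_{s₁} ∘ P_{s₂} ∘ ⋯ ∘ P_{sₘ})(K)` for `Π = {t 0 < ⋯ < t m}`, where
`sᵢ = t (i - 1) / t i`. -/
def partitionPower {n : ℕ} (t : ℕ → ℝ) :
    ℕ → Set (EuclideanSpace ℝ (Fin n)) → Set (EuclideanSpace ℝ (Fin n))
  | 0, K => K
  | m + 1, K => partitionPower t m (naivePower (t m / t (m + 1)) K)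

/-- The power `K ^ lam` for `0 < lam ≤ 1`: the closure of the union of the sets `P_Π(K)` over all
partitions `Π` of `[lam, 1]`. -/
def bodyPower {n : ℕ} (K : Set (EuclideanSpace ℝ (Fin n))) (lam : ℝ) :
    Set (EuclideanSpace ℝ (Fin n)) :=
  closure {x | ∃ (m : ℕ) (t : ℕ → ℝ), IsPartition lam 1 m t ∧ x ∈ partitionPower t m K}

end

/-! The core is the one-step bound |P_s(K)| ≤ |B|^(1-s) |K|^s for 0 < s < 1
(`volume_naivePower_le`). A nonzero p in S_s(K) has multiples αp in B and βp in the closure of K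
with α^(1-s) β^s = 1, namely p/‖p‖ and ‖p‖^(1/s) p/‖p‖. Take the polytope spanned by 0 and finitely
many such p, and cut it, up to a null set, into simplices with apex 0 over its facets. Scaling the
vertices of each simplex by the α's (or the β's) multiplies its volume by the product of the
factors, keeps it in its own cone, and puts it inside B (or the closure of K) by convexity. So each
simplex has volume at most the weighted geometric mean of two scaled simplices, each family is
disjoint, and Hölder's inequality sums the estimates (`measure_pointedHull_le_of_generic`). A small
generic rescaling of the points makes all facets simplices (`exists_weights_linearIndepOn`), and
polytopes exhaust the convex hull (`measure_convexHull_le`).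

Along a partition the exponents s_i multiply and telescope to λ. Since S_{rs}(K) = S_r(S_s(K)),
refining a partition enlarges P_Π(K), so these sets form a directed family of convex sets
(`IsPartition.exists_refinement`). A uniform volume bound on such a family passes to the closure of
its union (`measure_closure_iUnion_le_of_directed`). -/

/-- The half-open simplex spanned by the origin and the vectors `α i • b i`, where `b` is a basis:
the points with positive coordinates `c i` such that `∑ i, c i / α i ≤ 1`. -/
def basisSimplex {κ E : Type*} [Fintype κ] [NormedAddCommGroup E] [NormedSpace ℝ E]
    (b : Module.Basis κ ℝ E) (α : κ → ℝ) : Set E :=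
  {p | (∀ i, 0 < b.repr p i) ∧ ∑ i, b.repr p i / α i ≤ 1}

/-- The polytope spanned by the origin and finitely many vectors. -/
def pointedHull {ι E : Type*} [Fintype ι] [NormedAddCommGroup E] [NormedSpace ℝ E]
    (x : ι → E) : Set E :=
  (fun c : ι → ℝ => ∑ i, c i • x i) '' {c | (∀ i, 0 ≤ c i) ∧ ∑ i, c i ≤ 1}

/-! ### Simplices and polytopes with a vertex at the origin -/

section Simplex

variable {κ ι E : Type*} [Fintype κ] [Fintype ι] [NormedAddCommGroup E] [NormedSpace ℝ E]

theorem convex_pointedHull (x : ι → E) : Convex ℝ (pointedHull x) := by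
  rintro _ ⟨c, ⟨hc, hc1⟩, rfl⟩ _ ⟨d, ⟨hd, hd1⟩, rfl⟩ a b ha hb hab
  refine ⟨fun i => a * c i + b * d i, ⟨fun i => ?_, ?_⟩, ?_⟩
  · have := hc i
    have := hd i
    positivity
  · rw [Finset.sum_add_distrib, ← Finset.mul_sum, ← Finset.mul_sum]
    nlinarith
  · simp [Finset.smul_sum, add_smul, mul_smul, Finset.sum_add_distrib]

theorem isCompact_pointedHull (x : ι → E) : IsCompact (pointedHull x) := by
  refine IsCompact.image ?_ (by fun_prop)
  refine IsCompact.of_isClosed_subset (isCompact_Icc (a := (0 : ι → ℝ)) (b := 1)) ?_ ?_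
  · simp only [ofPred_and, ofPred_forall]
    exact (isClosed_iInter fun i => isClosed_le (by fun_prop) (by fun_prop)).inter
      (isClosed_le (by fun_prop) (by fun_prop))
  · rintro c ⟨hc, hc1⟩
    exact ⟨hc, fun i => (Finset.single_le_sum (fun j _ => hc j) (Finset.mem_univ i)).trans hc1⟩

theorem zero_mem_pointedHull (x : ι → E) : (0 : E) ∈ pointedHull x :=
  ⟨0, by simp, by simp⟩

theorem mem_pointedHull (x : ι → E) (i : ι) : x i ∈ pointedHull x := by
  classical
  refine ⟨Pi.single i 1, ⟨fun j => ?_, ?_⟩, ?_⟩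
  · by_cases h : j = i <;> simp [h]
  · simp
  · simp [Pi.single_apply]

theorem sum_smul_mem_of_convex {A : Set E} (hA : Convex ℝ A) (h0 : (0 : E) ∈ A) {y : κ → E}
    (hy : ∀ i, y i ∈ A) {c : κ → ℝ} (hc : ∀ i, 0 ≤ c i) (hc1 : ∑ i, c i ≤ 1) :
    ∑ i, c i • y i ∈ A := by
  -- The extra index `none` puts the missing mass 1 - ∑ c i at the origin.
  have := hA.sum_mem (t := (Finset.univ : Finset (Option κ)))
    (w := fun o => o.elim (1 - ∑ i, c i) c) (z := fun o => o.elim 0 y) ?_ ?_ ?_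
  · simpa [Fintype.sum_option] using this
  · rintro (_ | i) _
    · simpa using hc1
    · exact hc i
  · simp [Fintype.sum_option]
  · rintro (_ | i) _
    · exact h0
    · exact hy i

theorem basisSimplex_subset (b : Module.Basis κ ℝ E) {α : κ → ℝ} (hα : ∀ i, 0 < α i) {A : Set E}
    (hA : Convex ℝ A) (h0 : (0 : E) ∈ A) (h : ∀ i, α i • b i ∈ A) : basisSimplex b α ⊆ A := by
  rintro p ⟨hp, hp1⟩
  have := sum_smul_mem_of_convex hA h0 h (c := fun i => b.repr p i / α i)
    (fun i => (div_pos (hp i) (hα i)).le) hp1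
  have e : ∀ i, (b.repr p i / α i) • α i • b i = b.repr p i • b i := fun i => by
    rw [smul_smul, div_mul_cancel₀ _ (hα i).ne']
  simpa only [e, b.sum_repr] using this

variable [FiniteDimensional ℝ E] [MeasurableSpace E] [BorelSpace E]

theorem measurableSet_basisSimplex (b : Module.Basis κ ℝ E) (α : κ → ℝ) :
    MeasurableSet (basisSimplex b α) := by
  have hc : ∀ i, Continuous fun p => b.repr p i := fun i =>
    (b.coord i).continuous_of_finiteDimensional
  have h : basisSimplex b α =
      (⋂ i, {p | 0 < b.repr p i}) ∩ {p | ∑ i, b.repr p i / α i ≤ 1} := by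
    ext p
    simp [basisSimplex]
  rw [h]
  exact (MeasurableSet.iInter fun i => measurableSet_lt measurable_const (hc i).measurable).inter
    (measurableSet_le (Finset.measurable_sum _ fun i _ => ((hc i).div_const _).measurable)
      measurable_const)

/-- The diagonal map with entries `α i` in the basis `b` carries the unit simplex onto this one. -/
theorem measure_basisSimplex (μ : Measure E) [μ.IsAddHaarMeasure] (b : Module.Basis κ ℝ E)
    {α : κ → ℝ} (hα : ∀ i, 0 < α i) :
    μ (basisSimplex b α) = ENNReal.ofReal (∏ i, α i) * μ (basisSimplex b 1) := by
  classical
  set M : E →ₗ[ℝ] E := Matrix.toLin b b (Matrix.diagonal α)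
  have hdet : LinearMap.det M = ∏ i, α i := by
    rw [LinearMap.det_toLin, Matrix.det_diagonal]
  have hpos : 0 < ∏ i, α i := Finset.prod_pos fun i _ => hα i
  have hrepr : ∀ p i, b.repr (M p) i = α i * b.repr p i := fun p i => by
    rw [Matrix.repr_toLin, Matrix.mulVec_diagonal]
  have hpre : M ⁻¹' basisSimplex b α = basisSimplex b 1 := by
    ext p
    have e : ∀ i, α i * b.repr p i / α i = b.repr p i := fun i => by
      field_simp [(hα i).ne']
    simp [basisSimplex, hrepr, e, hα]
  have h := Measure.addHaar_preimage_linearMap μ (f := M) (by rw [hdet]; exact hpos.ne')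
    (basisSimplex b α)
  rw [hpre, hdet, abs_of_pos (inv_pos.2 hpos)] at h
  rw [h, ← mul_assoc, ← ENNReal.ofReal_mul hpos.le, mul_inv_cancel₀ hpos.ne', ENNReal.ofReal_one,
    one_mul]

/-- The right side is exactly the unit simplex's measure times ∏ α_i^(1-s) β_i^s, and every factor
of that product is at least 1. -/
theorem measure_basisSimplex_le (μ : Measure E) [μ.IsAddHaarMeasure] (b : Module.Basis κ ℝ E)
    {α β : κ → ℝ} (hα : ∀ i, 0 < α i) (hβ : ∀ i, 0 < β i) {s : ℝ} (hs0 : 0 < s) (hs1 : s < 1)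
    (h : ∀ i, 1 ≤ α i ^ (1 - s) * β i ^ s) :
    μ (basisSimplex b 1) ≤ μ (basisSimplex b α) ^ (1 - s) * μ (basisSimplex b β) ^ s := by
  have hs : 0 < 1 - s := sub_pos.2 hs1
  have hprod : 1 ≤ (∏ i, α i) ^ (1 - s) * (∏ i, β i) ^ s := by
    rw [← Real.finsetProd_rpow _ _ fun i _ => (hα i).le, ← Real.finsetProd_rpow _ _ fun i _ => (hβ i).le,
      ← Finset.prod_mul_distrib]
    exact Finset.one_le_prod fun i _ => h i
  have hα' : 0 < ∏ i, α i := Finset.prod_pos fun i _ => hα i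
  have hβ' : 0 < ∏ i, β i := Finset.prod_pos fun i _ => hβ i
  rw [measure_basisSimplex μ b hα, measure_basisSimplex μ b hβ, ENNReal.mul_rpow_of_nonneg _ _ hs.le,
    ENNReal.mul_rpow_of_nonneg _ _ hs0.le, mul_mul_mul_comm,
    ← ENNReal.rpow_add_of_nonneg _ _ hs.le hs0.le, sub_add_cancel, ENNReal.rpow_one,
    ENNReal.ofReal_rpow_of_pos hα', ENNReal.ofReal_rpow_of_pos hβ', ← ENNReal.ofReal_mul (by positivity)]
  refine le_mul_of_one_le_left zero_le ?_
  rwa [ENNReal.one_le_ofReal]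

end Simplex

/-- Hölder's inequality with conjugate exponents 1/(1-s) and 1/s. -/
theorem ENNReal.sum_rpow_mul_rpow_le {ι : Type*} (t : Finset ι) (a c : ι → ENNReal) {s : ℝ}
    (hs0 : 0 < s) (hs1 : s < 1) :
    ∑ i ∈ t, a i ^ (1 - s) * c i ^ s ≤ (∑ i ∈ t, a i) ^ (1 - s) * (∑ i ∈ t, c i) ^ s := by
  have hs : 0 < 1 - s := sub_pos.2 hs1
  have hpq : (1 - s)⁻¹.HolderConjugate s⁻¹ := by
    rw [Real.holderConjugate_iff]
    refine ⟨(one_lt_inv₀ hs).2 (by linarith), by simp⟩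
  have := ENNReal.inner_le_Lp_mul_Lq t (fun i => a i ^ (1 - s)) (fun i => c i ^ s) hpq
  simpa [← ENNReal.rpow_mul, hs.ne', hs0.ne'] using this

/-- A facet of `pointedHull x` off the origin, given by the indices of the vectors on it. -/
def IsSpanningFacet {ι E : Type*} [NormedAddCommGroup E] [NormedSpace ℝ E] (x : ι → E)
    (F : Finset ι) : Prop :=
  (∃ f : E →L[ℝ] ℝ, (∀ j, f (x j) ≤ 1) ∧ ∀ j, j ∈ F ↔ f (x j) = 1) ∧
    Submodule.span ℝ (x '' F) = ⊤

/-! ### Decomposition of a polytope over its simplicial facets -/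

section Facet

variable {ι E : Type*} [NormedAddCommGroup E] [NormedSpace ℝ E]

/-- Let p be the common point. Expanding p over F gives g(p) ≤ f(p), as f = 1 ≥ g there; expanding
it over G gives f(p) ≤ g(p) term by term. Equality of the sums forces f = 1 at every vertex of G.
This makes the open cones over distinct facets disjoint. -/
theorem IsSpanningFacet.subset_of_sum_eq {x : ι → E} {F G : Finset ι} (hF : IsSpanningFacet x F)
    (hG : IsSpanningFacet x G) {c d : ι → ℝ} (hc : ∀ i ∈ F, 0 < c i) (hd : ∀ i ∈ G, 0 < d i)
    (h : ∑ i ∈ F, c i • x i = ∑ i ∈ G, d i • x i) : G ⊆ F := by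
  obtain ⟨⟨f, hf, hfF⟩, -⟩ := hF
  obtain ⟨⟨g, hg, hgG⟩, -⟩ := hG
  have hgc : ∑ i ∈ F, c i * g (x i) ≤ ∑ i ∈ F, c i * f (x i) :=
    Finset.sum_le_sum fun i hi =>
      mul_le_mul_of_nonneg_left (((hfF i).1 hi).symm ▸ hg i) (hc i hi).le
  have e1 : ∑ i ∈ F, c i * f (x i) = ∑ i ∈ G, d i * f (x i) := by
    simpa using congrArg f h
  have e2 : ∑ i ∈ F, c i * g (x i) = ∑ i ∈ G, d i * g (x i) := by
    simpa using congrArg g h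
  have hle : ∀ i ∈ G, d i * f (x i) ≤ d i * g (x i) := fun i hi =>
    mul_le_mul_of_nonneg_left (((hgG i).1 hi).symm ▸ hf i) (hd i hi).le
  have heq := (Finset.sum_eq_sum_iff_of_le hle).1
    (le_antisymm (Finset.sum_le_sum hle) (by rw [← e1, ← e2]; exact hgc))
  intro i hi
  rw [hfF, ← (hgG i).1 hi]
  exact mul_left_cancel₀ (hd i hi).ne' (heq i hi)

theorem IsSpanningFacet.eq_of_sum_eq {x : ι → E} {F G : Finset ι} (hF : IsSpanningFacet x F)
    (hG : IsSpanningFacet x G) {c d : ι → ℝ} (hc : ∀ i ∈ F, 0 < c i) (hd : ∀ i ∈ G, 0 < d i)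
    (h : ∑ i ∈ F, c i • x i = ∑ i ∈ G, d i • x i) : F = G :=
  (hG.subset_of_sum_eq hF hd hc h.symm).antisymm (hF.subset_of_sum_eq hG hc hd h)

theorem sum_smul_mem_span_image {x : ι → E} (F : Finset ι) (c : ι → ℝ) {G : Finset ι}
    (h : ∀ i ∈ F, c i ≠ 0 → i ∈ G) :
    ∑ i ∈ F, c i • x i ∈ Submodule.span ℝ (x '' (G : Set ι)) := by
  refine Submodule.sum_mem _ fun i hi => ?_
  by_cases h0 : c i = 0
  · simp [h0]
  · exact Submodule.smul_mem _ _ (Submodule.subset_span ⟨i, h i hi h0, rfl⟩)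

/-- Away from the lower-dimensional spans, every point of the polytope lies in the simplex over
one of its facets, provided the facets are simplices. -/
theorem exists_spanningFacet [Fintype ι] [Nontrivial E] {x : ι → E}
    (hx : ∀ f : E →L[ℝ] ℝ, LinearIndepOn ℝ x {i | f (x i) = 1})
    (hint : (interior (pointedHull x)).Nonempty) {p : E} (hp : p ∈ pointedHull x)
    (hspan : ∀ G : Finset ι, p ∈ Submodule.span ℝ (x '' (G : Set ι)) →
      Submodule.span ℝ (x '' (G : Set ι)) = ⊤) :
    ∃ F : Finset ι, IsSpanningFacet x F ∧ ∃ c : ι → ℝ, (∀ i ∈ F, 0 < c i) ∧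
      ∑ i ∈ F, c i ≤ 1 ∧ p = ∑ i ∈ F, c i • x i := by
  classical
  have hp0 : p ≠ 0 := by
    rintro rfl
    have := hspan ∅ (zero_mem _)
    simp at this
  have hcomp : IsCompact {t : ℝ | t • p ∈ pointedHull x} :=
    (isClosedEmbedding_smul_left hp0).isCompact_preimage (isCompact_pointedHull x)
  -- Push p outwards along its ray to the last point t • p of the polytope; a functional supporting
  -- the polytope there exposes the facet.
  obtain ⟨t, ht, htmax⟩ := hcomp.exists_isGreatest ⟨1, by simpa using hp⟩
  have ht1 : 1 ≤ t := htmax (by simpa using hp)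
  have hq : t • p ∉ interior (pointedHull x) := by
    intro hmem
    have hcont : ContinuousAt (fun r : ℝ => r • p) t := by fun_prop
    have hev := hcont.eventually (isOpen_interior.mem_nhds hmem)
    obtain ⟨r, hr, hrt⟩ := ((hev.filter_mono nhdsWithin_le_nhds).and
      (self_mem_nhdsWithin (s := Ioi t))).exists
    exact absurd (htmax (show r • p ∈ pointedHull x from interior_subset hr)) (not_le.2 hrt)
  obtain ⟨f, hf⟩ := geometric_hahn_banach_open_point (convex_pointedHull x).interior
    isOpen_interior hq
  have hfle : ∀ a ∈ pointedHull x, f a ≤ f (t • p) := by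
    intro a ha
    have hcl : a ∈ closure (interior (pointedHull x)) := by
      rw [(convex_pointedHull x).closure_interior_eq_closure_of_nonempty_interior hint]
      exact subset_closure ha
    exact closure_minimal (fun b hb => (hf b hb).le)
      (isClosed_le f.continuous continuous_const) hcl
  have hM : 0 ≤ f (t • p) := by simpa using hfle 0 (zero_mem_pointedHull x)
  obtain ⟨c, ⟨hc, hc1⟩, hcq⟩ := ht
  have hcq : ∑ i, c i • x i = t • p := hcq
  have hfq : ∑ i, c i * f (x i) = f (t • p) := by
    simpa using congrArg f hcq
  have ht0 : t ≠ 0 := by linarith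
  have hmem : ∀ G : Finset ι, (∀ i, c i ≠ 0 → i ∈ G) →
      p ∈ Submodule.span ℝ (x '' (G : Set ι)) := by
    intro G hG
    have h := sum_smul_mem_span_image (x := x) Finset.univ c (G := G) fun i _ => hG i
    rw [hcq] at h
    exact (Submodule.smul_mem_iff _ ht0).1 h
  -- Complementary slackness: the supporting functional attains its maximum at t • p, so only
  -- vertices on the supporting hyperplane carry weight.
  have hzero : ∀ i, c i * (f (t • p) - f (x i)) = 0 := by
    have hnn : ∀ i ∈ Finset.univ, 0 ≤ c i * (f (t • p) - f (x i)) := fun i _ =>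
      mul_nonneg (hc i) (sub_nonneg.2 (hfle _ (mem_pointedHull x i)))
    have hsum : ∑ i, c i * (f (t • p) - f (x i)) ≤ 0 := by
      simp only [mul_sub, Finset.sum_sub_distrib, hfq, ← Finset.sum_mul]
      nlinarith
    intro i
    exact (Finset.sum_eq_zero_iff_of_nonneg hnn).1
      (le_antisymm hsum (Finset.sum_nonneg hnn)) i (Finset.mem_univ i)
  have hface : ∀ i, c i ≠ 0 → f (x i) = f (t • p) := fun i hi =>
    (sub_eq_zero.1 ((mul_eq_zero.1 (hzero i)).resolve_left hi)).symm
  set F : Finset ι := {i | f (x i) = f (t • p)} with hFdef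
  have hFspan := hspan F (hmem F fun i hi => by simpa [hFdef] using hface i hi)
  -- Otherwise f vanishes on the spanning set x '' F, hence everywhere, contradicting strict
  -- separation from the interior. Positivity allows normalising f to value 1 on the facet.
  have hMpos : 0 < f (t • p) := by
    refine hM.lt_of_ne' fun h0 => ?_
    have hf0 : ∀ v, f v = 0 := by
      intro v
      have hv : v ∈ Submodule.span ℝ (x '' (F : Set ι)) := by rw [hFspan]; trivial
      have hle : Submodule.span ℝ (x '' (F : Set ι)) ≤ LinearMap.ker (f : E →ₗ[ℝ] ℝ) := by
        rw [Submodule.span_le]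
        rintro _ ⟨i, hi, rfl⟩
        simpa [hFdef, h0] using hi
      simpa using hle hv
    obtain ⟨a, ha⟩ := hint
    have := hf a ha
    rw [hf0, hf0] at this
    exact lt_irrefl _ this
  set g : E →L[ℝ] ℝ := (f (t • p))⁻¹ • f with hgdef
  have hgF : ∀ j, j ∈ F ↔ g (x j) = 1 := by
    intro j
    rw [hFdef, hgdef, Finset.mem_filter_univ, _root_.smul_apply, smul_eq_mul,
      inv_mul_eq_one₀ hMpos.ne', eq_comm]
  have hind : LinearIndepOn ℝ x (F : Set ι) := by
    have : (F : Set ι) = {i | g (x i) = 1} := by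
      ext j
      simpa using hgF j
    rw [this]
    exact hx g
  refine ⟨F, ⟨⟨g, fun j => ?_, hgF⟩, hFspan⟩, fun i => t⁻¹ * c i, fun i hi => ?_, ?_, ?_⟩
  · rw [hgdef, _root_.smul_apply, smul_eq_mul, inv_mul_le_one₀ hMpos]
    exact hfle _ (mem_pointedHull x j)
  · refine mul_pos (by positivity) ((hc i).lt_of_ne' fun h0 => ?_)
    -- If c i were 0, then p would lie in the span of the other vertices, which would then be the
    -- whole space, against linear independence on F.
    have hsp := hspan (F.erase i) (hmem _ fun j hj => by
      refine Finset.mem_erase.2 ⟨fun hji => hj (hji ▸ h0), by simpa [hFdef] using hface j hj⟩)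
    have hnot := hind.notMem_span (i := i) hi
    rw [← Finset.coe_erase, hsp] at hnot
    exact hnot trivial
  · have h1 : ∑ i ∈ F, c i ≤ 1 :=
      (Finset.sum_le_sum_of_subset_of_nonneg (Finset.subset_univ F) fun i _ _ => hc i).trans hc1
    have h0 : 0 ≤ ∑ i ∈ F, c i := Finset.sum_nonneg fun i _ => hc i
    rw [← Finset.mul_sum]
    exact mul_le_one₀ (inv_le_one_of_one_le₀ ht1) h0 h1
  · have : ∑ i ∈ F, c i • x i = t • p := by
      rw [← hcq]
      refine Finset.sum_subset (Finset.subset_univ F) fun i _ hi => ?_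
      have : c i = 0 := by
        by_contra hne
        exact hi (by simpa [hFdef] using hface i hne)
      simp [this]
    simp only [mul_smul]
    rw [← Finset.smul_sum, this, smul_smul, inv_mul_cancel₀ ht0, one_smul]

/-- The hypothesis `hx` makes the vertices of every facet off the origin linearly independent, so a
spanning facet gives a basis and a simplex with apex 0. These simplices cover the polytope up to
finitely many proper subspaces. -/
theorem measure_pointedHull_le_of_generic [Fintype ι] [Nontrivial E] [FiniteDimensional ℝ E]
    [MeasurableSpace E] [BorelSpace E] (μ : Measure E) [μ.IsAddHaarMeasure] {x : ι → E}
    (hx : ∀ f : E →L[ℝ] ℝ, LinearIndepOn ℝ x {i | f (x i) = 1}) {A C : Set E}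
    (hA : Convex ℝ A) (hA0 : (0 : E) ∈ A) (hC : Convex ℝ C) (hC0 : (0 : E) ∈ C) {α β : ι → ℝ}
    (hα : ∀ i, 0 < α i) (hβ : ∀ i, 0 < β i) {s : ℝ} (hs0 : 0 < s) (hs1 : s < 1)
    (h : ∀ i, 1 ≤ α i ^ (1 - s) * β i ^ s) (hαA : ∀ i, α i • x i ∈ A)
    (hβC : ∀ i, β i • x i ∈ C) :
    μ (pointedHull x) ≤ μ A ^ (1 - s) * μ C ^ s := by
  classical
  by_cases hint : (interior (pointedHull x)).Nonempty
  swap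
  · have : μ (pointedHull x) = 0 := by
      refine measure_mono_null ?_ ((convex_pointedHull x).addHaar_frontier μ)
      rw [frontier, not_nonempty_iff_eq_empty.1 hint, sdiff_empty]
      exact subset_closure
    rw [this]
    exact zero_le
  have hbasis : ∀ F : {F : Finset ι // IsSpanningFacet x F}, ∃ b : Module.Basis F.1 ℝ E,
      ∀ i, b i = x i := by
    intro F
    obtain ⟨⟨f, hf, hfF⟩, hF⟩ := F.2
    have hind : LinearIndepOn ℝ x (F.1 : Set ι) := by
      have : (F.1 : Set ι) = {i | f (x i) = 1} := by
        ext j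
        simpa using hfF j
      rw [this]
      exact hx f
    have htop : ⊤ ≤ Submodule.span ℝ (range fun i : F.1 => x i) := by
      rw [← hF, image_eq_range]
      exact le_rfl
    exact ⟨Module.Basis.mk hind htop, fun i => Module.Basis.mk_apply hind htop i⟩
  choose b hb using hbasis
  have hcover : pointedHull x ⊆ (⋃ G : {G : Finset ι //
      Submodule.span ℝ (x '' (G : Set ι)) ≠ ⊤}, (Submodule.span ℝ (x '' (G.1 : Set ι)) : Set E)) ∪
      ⋃ F, basisSimplex (b F) 1 := by
    intro p hp
    by_cases hN : ∃ G : Finset ι, p ∈ Submodule.span ℝ (x '' (G : Set ι)) ∧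
        Submodule.span ℝ (x '' (G : Set ι)) ≠ ⊤
    · obtain ⟨G, hG, hG'⟩ := hN
      exact Or.inl (mem_iUnion.2 ⟨⟨G, hG'⟩, hG⟩)
    · push Not at hN
      obtain ⟨F, hF, c, hc, hc1, rfl⟩ := exists_spanningFacet hx hint hp hN
      refine Or.inr (mem_iUnion.2 ⟨⟨F, hF⟩, ?_⟩)
      have e : ∑ i ∈ F, c i • x i = ∑ i : F, c i • b ⟨F, hF⟩ i := by
        simp only [hb]
        exact (Finset.sum_coe_sort F fun i => c i • x i).symm
      have hr : ∀ i : F, (b ⟨F, hF⟩).repr (∑ i ∈ F, c i • x i) i = c i := fun i => by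
        rw [e, (b ⟨F, hF⟩).repr_sum_self fun i : F => c i]
      refine ⟨fun i => by rw [hr]; exact hc i i.2, ?_⟩
      simp only [hr, Pi.one_apply, div_one]
      rwa [Finset.sum_coe_sort F c]
  have hnull : μ (⋃ G : {G : Finset ι // Submodule.span ℝ (x '' (G : Set ι)) ≠ ⊤},
      (Submodule.span ℝ (x '' (G.1 : Set ι)) : Set E)) = 0 :=
    measure_iUnion_null fun G => Measure.addHaar_submodule μ _ G.2
  -- Disjointness holds for any scaling γ, because it depends only on the open cones; it is needed
  -- for both α and β.
  have hdisj : ∀ γ : ι → ℝ, Pairwise (Function.onFun Disjoint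
      fun F : {F : Finset ι // IsSpanningFacet x F} => basisSimplex (b F) fun i => γ i) := by
    intro γ F G hFG
    refine Set.disjoint_left.2 fun p hpF hpG => hFG (Subtype.ext ?_)
    have key : ∀ H : {F : Finset ι // IsSpanningFacet x F},
        p ∈ basisSimplex (b H) (fun i => γ i) →
        ∃ c : ι → ℝ, (∀ i ∈ H.1, 0 < c i) ∧ ∑ i ∈ H.1, c i • x i = p := by
      intro H hpH
      refine ⟨fun i => if hi : i ∈ H.1 then (b H).repr p ⟨i, hi⟩ else 0, fun i hi => ?_, ?_⟩
      · simpa [hi] using hpH.1 ⟨i, hi⟩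
      · rw [← Finset.sum_coe_sort]
        conv_rhs => rw [← (b H).sum_repr p]
        simp [hb]
    obtain ⟨c, hc, hcp⟩ := key F hpF
    obtain ⟨d, hd, hdp⟩ := key G hpG
    exact F.2.eq_of_sum_eq G.2 hc hd (hcp.trans hdp.symm)
  have hsum : ∀ (γ : ι → ℝ) (D : Set E), (∀ i, 0 < γ i) → Convex ℝ D → (0 : E) ∈ D →
      (∀ i, γ i • x i ∈ D) → ∑ F, μ (basisSimplex (b F) fun i => γ i) ≤ μ D := by
    intro γ D hγ hD hD0 hγD
    rw [← tsum_fintype (L := .unconditional _), ← measure_iUnion (hdisj γ) fun F => measurableSet_basisSimplex _ _]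
    exact measure_mono (iUnion_subset fun F => basisSimplex_subset (b F) (fun i => hγ i) hD hD0
      fun i => by rw [hb]; exact hγD i)
  calc μ (pointedHull x) ≤ 0 + μ (⋃ F, basisSimplex (b F) 1) := by
        rw [← hnull]
        exact (measure_mono hcover).trans (measure_union_le _ _)
    _ ≤ ∑ F, μ (basisSimplex (b F) 1) := by
        rw [zero_add]
        exact measure_iUnion_fintype_le μ _
    _ ≤ ∑ F, μ (basisSimplex (b F) fun i => α i) ^ (1 - s) *
          μ (basisSimplex (b F) fun i => β i) ^ s :=
        Finset.sum_le_sum fun F _ => measure_basisSimplex_le μ (b F) (fun i => hα i)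
          (fun i => hβ i) hs0 hs1 fun i => h i
    _ ≤ _ := ENNReal.sum_rpow_mul_rpow_le _ _ _ hs0 hs1
    _ ≤ _ := by
        have hs : 0 ≤ 1 - s := by linarith
        exact mul_le_mul' (ENNReal.rpow_le_rpow (hsum α A hα hA hA0 hαA) hs)
          (ENNReal.rpow_le_rpow (hsum β C hβ hC hC0 hβC) hs0.le)

end Facet

/-! ### Generic rescaling of the vertices -/

section Perturbation

open scoped Pointwise

variable {ι E : Type*} [Fintype ι] [NormedAddCommGroup E] [NormedSpace ℝ E]

/-- A relation ∑ a_i x_i = 0 among points with f(x_i) = w_i forces ∑ a_i w_i = 0. Choosing one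
nontrivial relation for each dependent subset leaves finitely many hyperplanes for w to avoid; they
are null, while the open cube of admissible weights is not. -/
theorem exists_weights_linearIndepOn (x : ι → E) {ε : ℝ} (hε : 0 < ε) :
    ∃ w : ι → ℝ, (∀ i, 1 < w i ∧ w i < 1 + ε) ∧
      ∀ f : E →L[ℝ] ℝ, LinearIndepOn ℝ x {i | f (x i) = w i} := by
  classical
  have hrel : ∀ G : {G : Finset ι // ¬ LinearIndepOn ℝ x (G : Set ι)},
      ∃ a : ι → ℝ, ∑ i ∈ G.1, a i • x i = 0 ∧ ∃ i ∈ G.1, a i ≠ 0 := fun G =>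
    not_linearIndepOn_finset_iff.1 G.2
  choose a ha0 ha1 using hrel
  let φ : {G : Finset ι // ¬ LinearIndepOn ℝ x (G : Set ι)} → (ι → ℝ) →ₗ[ℝ] ℝ := fun G =>
    ∑ i ∈ G.1, a G i • LinearMap.proj i
  have hφ : ∀ G w, φ G w = ∑ i ∈ G.1, a G i * w i := fun G w => by simp [φ]
  have hnull : volume (⋃ G, (LinearMap.ker (φ G) : Set (ι → ℝ))) = 0 := by
    refine measure_iUnion_null fun G => Measure.addHaar_submodule _ _ fun htop => ?_
    obtain ⟨i, hi, hai⟩ := ha1 G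
    have : Pi.single i 1 ∈ LinearMap.ker (φ G) := by rw [htop]; trivial
    rw [LinearMap.mem_ker, hφ] at this
    simp [Pi.single_apply, hi] at this
    exact hai this
  have hpos : 0 < volume (univ.pi fun _ : ι => Ioo (1 : ℝ) (1 + ε)) := by
    refine IsOpen.measure_pos _ (isOpen_set_pi finite_univ fun i _ => isOpen_Ioo) ?_
    exact univ_pi_nonempty_iff.2 fun i => nonempty_Ioo.2 (by linarith)
  obtain ⟨w, hw, hwN⟩ : ((univ.pi fun _ : ι => Ioo (1 : ℝ) (1 + ε)) \
      ⋃ G, (LinearMap.ker (φ G) : Set (ι → ℝ))).Nonempty := by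
    refine nonempty_of_measure_ne_zero (μ := volume) ?_
    rw [measure_sdiff_null hnull]
    exact hpos.ne'
  refine ⟨w, fun i => hw i trivial, fun f => ?_⟩
  by_contra hcon
  have hset : {i | f (x i) = w i} = ((Finset.univ.filter fun i => f (x i) = w i : Finset ι) : Set ι) := by
    simp
  rw [hset] at hcon
  refine hwN (mem_iUnion.2 ⟨⟨_, hcon⟩, ?_⟩)
  rw [SetLike.mem_coe, LinearMap.mem_ker, hφ]
  have h0 := congrArg f (ha0 ⟨_, hcon⟩)
  simp only [map_sum, map_smul, smul_eq_mul, map_zero] at h0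
  rw [← h0]
  refine Finset.sum_congr rfl fun i hi => ?_
  rw [(Finset.mem_filter.1 hi).2]

theorem pointedHull_subset_smul {x : ι → E} {w : ι → ℝ} {ε : ℝ} (hε : 0 < ε)
    (hw : ∀ i, 1 < w i ∧ w i < 1 + ε) :
    pointedHull x ⊆ (1 + ε) • pointedHull fun i => (w i)⁻¹ • x i := by
  rintro _ ⟨c, ⟨hc, hc1⟩, rfl⟩
  have hw0 : ∀ i, 0 < w i := fun i => by linarith [(hw i).1]
  have hε1 : 0 < 1 + ε := by linarith
  refine ⟨_, ⟨fun i => (1 + ε)⁻¹ * (w i * c i), ⟨fun i => ?_, ?_⟩, rfl⟩, ?_⟩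
  · have := hc i
    have := hw0 i
    positivity
  · rw [← Finset.mul_sum, inv_mul_le_one₀ hε1]
    calc ∑ i, w i * c i ≤ ∑ i, (1 + ε) * c i :=
          Finset.sum_le_sum fun i _ => mul_le_mul_of_nonneg_right (hw i).2.le (hc i)
      _ ≤ 1 + ε := by
          rw [← Finset.mul_sum]
          exact mul_le_of_le_one_right hε1.le hc1
  · simp only [Finset.smul_sum, smul_smul]
    refine Finset.sum_congr rfl fun i _ => ?_
    congr 1
    field_simp [(hw0 i).ne', hε1.ne']

/-- Replacing x_i by x_i / w_i and the multipliers by α_i w_i, β_i w_i leaves the points in A and C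
unchanged, and keeps the geometric mean at least 1 since w_i > 1. The cost is a factor (1 + ε)^dim,
which tends to 1. -/
theorem measure_pointedHull_le [Nontrivial E] [FiniteDimensional ℝ E]
    [MeasurableSpace E] [BorelSpace E] (μ : Measure E) [μ.IsAddHaarMeasure] {x : ι → E}
    {A C : Set E}
    (hA : Convex ℝ A) (hA0 : (0 : E) ∈ A) (hC : Convex ℝ C) (hC0 : (0 : E) ∈ C) {α β : ι → ℝ}
    (hα : ∀ i, 0 < α i) (hβ : ∀ i, 0 < β i) {s : ℝ} (hs0 : 0 < s) (hs1 : s < 1)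
    (h : ∀ i, 1 ≤ α i ^ (1 - s) * β i ^ s) (hαA : ∀ i, α i • x i ∈ A)
    (hβC : ∀ i, β i • x i ∈ C) :
    μ (pointedHull x) ≤ μ A ^ (1 - s) * μ C ^ s := by
  have key : ∀ ε : ℝ, 0 < ε → μ (pointedHull x) ≤
      ENNReal.ofReal ((1 + ε) ^ Module.finrank ℝ E) * (μ A ^ (1 - s) * μ C ^ s) := by
    intro ε hε
    obtain ⟨w, hw, hgen⟩ := exists_weights_linearIndepOn x hε
    have hw0 : ∀ i, 0 < w i := fun i => by linarith [(hw i).1]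
    have hw1 : ∀ i, w i ≠ 0 := fun i => (hw0 i).ne'
    refine (measure_mono (pointedHull_subset_smul hε hw)).trans ?_
    rw [Measure.addHaar_smul, abs_of_pos (by positivity)]
    gcongr
    refine measure_pointedHull_le_of_generic μ (fun f => ?_) hA hA0 hC hC0
      (α := fun i => α i * w i) (β := fun i => β i * w i) (fun i => mul_pos (hα i) (hw0 i))
      (fun i => mul_pos (hβ i) (hw0 i)) hs0 hs1 (fun i => ?_) (fun i => ?_) fun i => ?_
    · have hset : {i | f ((w i)⁻¹ • x i) = 1} = {i | f (x i) = w i} := by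
        ext i
        simp only [map_smul, smul_eq_mul, mem_ofPred_eq]
        rw [inv_mul_eq_one₀ (hw1 i), eq_comm]
      rw [hset]
      exact (hgen f).linearIndependent.units_smul fun i => (Units.mk0 (w i) (hw1 i))⁻¹
    · rw [Real.mul_rpow (hα i).le (hw0 i).le, Real.mul_rpow (hβ i).le (hw0 i).le,
        mul_mul_mul_comm, ← Real.rpow_add (hw0 i), sub_add_cancel, Real.rpow_one]
      exact one_le_mul_of_one_le_of_one_le (h i) (hw i).1.le
    · rw [smul_smul, mul_assoc, mul_inv_cancel₀ (hw1 i), mul_one]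
      exact hαA i
    · rw [smul_smul, mul_assoc, mul_inv_cancel₀ (hw1 i), mul_one]
      exact hβC i
  set M := μ A ^ (1 - s) * μ C ^ s
  have hlim : Filter.Tendsto (fun ε : ℝ => ENNReal.ofReal ((1 + ε) ^ Module.finrank ℝ E) * M)
      (nhdsWithin 0 (Ioi 0)) (nhds (1 * M)) := by
    refine ENNReal.Tendsto.mul_const ?_ (Or.inl one_ne_zero)
    have : ContinuousAt (fun ε : ℝ => ENNReal.ofReal ((1 + ε) ^ Module.finrank ℝ E)) 0 :=
      (ENNReal.continuous_ofReal.comp (by fun_prop)).continuousAt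
    have h2 := this.tendsto
    simp only [add_zero, one_pow, ENNReal.ofReal_one] at h2
    exact h2.mono_left nhdsWithin_le_nhds
  rw [one_mul] at hlim
  exact ge_of_tendsto hlim (by filter_upwards [self_mem_nhdsWithin] with ε hε using key ε hε)

end Perturbation

/-! ### Directed unions of convex sets -/

section Exhaustion

variable {E : Type*} [NormedAddCommGroup E] [NormedSpace ℝ E] [FiniteDimensional ℝ E]

/-- An interior point of the union is interior to a simplex contained in it. The finitely many
vertices lie in a single D i by directedness, and so does the simplex by convexity. -/
theorem Directed.convex_iUnion_interior_subset {ι : Type*} {D : ι → Set E}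
    (hD : ∀ i, Convex ℝ (D i)) (hdir : Directed (· ⊆ ·) D) :
    interior (⋃ i, D i) ⊆ ⋃ i, interior (D i) := by
  intro x hx
  obtain ⟨b, hxb, hb⟩ := exists_mem_interior_convexHull_affineBasis
    (isOpen_interior.mem_nhds hx)
  have hsub : range b ⊆ ⋃ i, D i :=
    (subset_convexHull ℝ _).trans (hb.trans interior_subset)
  have : Nonempty ι := (mem_iUnion.1 (hsub ⟨0, rfl⟩)).nonempty
  obtain ⟨i, hi⟩ := hdir.exists_mem_subset_of_finset_subset_biUnion
    (s := (finite_range b).toFinset) (by simpa using hsub)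
  refine mem_iUnion.2 ⟨i, interior_mono (convexHull_min ?_ (hD i)) hxb⟩
  simpa using hi

variable [MeasurableSpace E] [BorelSpace E]

/-- The union is convex, so its frontier is null and its interior carries the measure of the
closure. A compact subset of that interior lies in one D i by the directed cover; inner regularity
concludes. -/
theorem measure_closure_iUnion_le_of_directed {ι : Type*} (μ : Measure E) [μ.IsAddHaarMeasure]
    {D : ι → Set E} (hD : ∀ i, Convex ℝ (D i)) (hdir : Directed (· ⊆ ·) D) {M : ENNReal}
    (hM : ∀ i, μ (D i) ≤ M) : μ (closure (⋃ i, D i)) ≤ M := by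
  have hconv : Convex ℝ (⋃ i, D i) := hdir.convex_iUnion fun i => hD i
  have h1 : μ (closure (⋃ i, D i)) ≤ μ (interior (⋃ i, D i)) := by
    rw [closure_eq_interior_union_frontier]
    refine (measure_union_le _ _).trans ?_
    rw [hconv.addHaar_frontier μ, add_zero]
  refine h1.trans ?_
  rw [isOpen_interior.measure_eq_iSup_isCompact μ]
  refine iSup_le fun L => iSup_le fun hL => iSup_le fun hLc => ?_
  obtain rfl | ⟨y, hy⟩ := L.eq_empty_or_nonempty
  · simp
  have hcov := hL.trans (Directed.convex_iUnion_interior_subset hD hdir)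
  have : Nonempty ι := (mem_iUnion.1 (hcov hy)).nonempty
  obtain ⟨i, hi⟩ := hLc.elim_directed_cover (fun i => interior (D i)) (fun i => isOpen_interior)
    hcov fun i j => by
      obtain ⟨k, hik, hjk⟩ := hdir i j
      exact ⟨k, interior_mono hik, interior_mono hjk⟩
  exact (measure_mono (hi.trans interior_subset)).trans (hM i)

/-- A convex hull inequality of Hölder type: if every nonzero `p ∈ S` lies below a geometric mean
of points of `A` and `C` on its ray, then so does the volume of the convex hull of `S`. -/
theorem measure_convexHull_le [Nontrivial E] (μ : Measure E) [μ.IsAddHaarMeasure] {S A C : Set E}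
    (hA : Convex ℝ A) (hA0 : (0 : E) ∈ A) (hC : Convex ℝ C) (hC0 : (0 : E) ∈ C) {s : ℝ}
    (hs0 : 0 < s) (hs1 : s < 1) (h : ∀ p ∈ S, p ≠ 0 → ∃ α β : ℝ, 0 < α ∧ 0 < β ∧
      1 ≤ α ^ (1 - s) * β ^ s ∧ α • p ∈ A ∧ β • p ∈ C) :
    μ (convexHull ℝ S) ≤ μ A ^ (1 - s) * μ C ^ s := by
  classical
  have hU : convexHull ℝ S = ⋃ t : {t : Finset E // (t : Set E) ⊆ S}, convexHull ℝ (t.1 : Set E) := by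
    rw [convexHull_eq_union_convexHull_finite_subsets, iUnion_subtype]
  refine (measure_mono subset_closure).trans ?_
  rw [hU]
  refine measure_closure_iUnion_le_of_directed μ (fun t => convex_convexHull ℝ _) ?_ ?_
  · intro t u
    refine ⟨⟨t.1 ∪ u.1, by rw [Finset.coe_union]; exact union_subset t.2 u.2⟩,
      convexHull_mono ?_, convexHull_mono ?_⟩ <;> simp
  · rintro ⟨t, ht⟩
    have h' : ∀ i : {p : t // (p : E) ≠ 0}, ∃ α β : ℝ, 0 < α ∧ 0 < β ∧
      1 ≤ α ^ (1 - s) * β ^ s ∧ α • (i.1 : E) ∈ A ∧ β • (i.1 : E) ∈ C := fun i =>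
        h _ (ht i.1.2) i.2
    choose α β hα hβ hαβ hαA hβC using h'
    refine (measure_mono (convexHull_min (fun p hp => ?_) (convex_pointedHull _))).trans
      (measure_pointedHull_le μ hA hA0 hC hC0 hα hβ hs0 hs1 hαβ hαA hβC)
    by_cases hp0 : p = 0
    · rw [hp0]
      exact zero_mem_pointedHull _
    · exact mem_pointedHull (fun i : {p : t // (p : E) ≠ 0} => (i.1 : E)) ⟨⟨p, hp⟩, hp0⟩

end Exhaustion

/-! ### Radial functions -/

section Radial

variable {n : ℕ}

theorem bddAbove_radial {K : Set (EuclideanSpace ℝ (Fin n))} {R : ℝ}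
    (hR : K ⊆ Metric.closedBall 0 R) {θ : EuclideanSpace ℝ (Fin n)} (hθ : ‖θ‖ = 1) :
    R ∈ upperBounds {t : ℝ | 0 ≤ t ∧ t • θ ∈ K} := by
  rintro t ⟨ht, htK⟩
  simpa [norm_smul, hθ, abs_of_nonneg ht] using hR htK

theorem le_radialFun {K : Set (EuclideanSpace ℝ (Fin n))} (hK : Bornology.IsBounded K)
    {θ : EuclideanSpace ℝ (Fin n)} (hθ : ‖θ‖ = 1) {t : ℝ} (ht : 0 ≤ t) (htK : t • θ ∈ K) :
    t ≤ radialFun K θ := by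
  obtain ⟨R, hR⟩ := hK.subset_closedBall 0
  exact le_csSup ⟨R, bddAbove_radial hR hθ⟩ ⟨ht, htK⟩

theorem radialFun_nonneg (K : Set (EuclideanSpace ℝ (Fin n))) (θ : EuclideanSpace ℝ (Fin n)) :
    0 ≤ radialFun K θ :=
  Real.sSup_nonneg fun _ h => h.1

theorem radialFun_mono {K L : Set (EuclideanSpace ℝ (Fin n))} (h0 : 0 ∈ K) (hKL : K ⊆ L)
    (hL : Bornology.IsBounded L) {θ : EuclideanSpace ℝ (Fin n)} (hθ : ‖θ‖ = 1) :
    radialFun K θ ≤ radialFun L θ :=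
  csSup_le ⟨0, le_rfl, by simpa using h0⟩ fun _ ht => le_radialFun hL hθ ht.1 (hKL ht.2)

/-- The closure is needed because K is not assumed closed, so the supremum defining the radial
function need not be attained. -/
theorem smul_mem_closure_of_le_radialFun {K : Set (EuclideanSpace ℝ (Fin n))} (hK : Convex ℝ K)
    (hb : Bornology.IsBounded K) (h0 : 0 ∈ K) {θ : EuclideanSpace ℝ (Fin n)} (hθ : ‖θ‖ = 1)
    {t : ℝ} (ht : 0 ≤ t) (htr : t ≤ radialFun K θ) : t • θ ∈ closure K := by
  obtain ⟨R, hR⟩ := hb.subset_closedBall 0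
  have hmem : radialFun K θ • θ ∈ closure K :=
    map_mem_closure (f := fun t : ℝ => t • θ) (by fun_prop)
      (csSup_mem_closure (s := {t : ℝ | 0 ≤ t ∧ t • θ ∈ K}) ⟨0, le_rfl, by simpa using h0⟩
        ⟨R, bddAbove_radial hR hθ⟩) fun t ht => ht.2
  obtain hr | hr := (radialFun_nonneg K θ).eq_or_lt
  · have : t = 0 := le_antisymm (hr ▸ htr) ht
    simpa [this] using subset_closure h0
  · have := hK.closure.smul_mem_of_zero_mem (subset_closure h0) hmem
      (t := t / radialFun K θ) ⟨by positivity, (div_le_one hr).2 htr⟩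
    rwa [smul_smul, div_mul_cancel₀ _ hr.ne'] at this

theorem norm_inv_smul_self {x : EuclideanSpace ℝ (Fin n)} (hx : x ≠ 0) : ‖‖x‖⁻¹ • x‖ = 1 := by
  simpa using norm_smul_inv_norm (𝕜 := ℝ) hx

end Radial

/-- Bounded convex sets with the origin in the interior. -/
structure IsBodyAroundZero {n : ℕ} (K : Set (EuclideanSpace ℝ (Fin n))) : Prop where
  convex : Convex ℝ K
  bounded : Bornology.IsBounded K
  zero_mem_interior : (0 : EuclideanSpace ℝ (Fin n)) ∈ interior K

/-! ### Naive powers and the one-step volume bound -/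

section Power

variable {n : ℕ} {K L : Set (EuclideanSpace ℝ (Fin n))} {s : ℝ}

theorem IsBodyAroundZero.zero_mem (hK : IsBodyAroundZero K) : (0 : EuclideanSpace ℝ (Fin n)) ∈ K :=
  interior_subset hK.zero_mem_interior

theorem IsBodyAroundZero.naivePower (hK : IsBodyAroundZero K) (hs : 0 < s) :
    IsBodyAroundZero (naivePower s K) := by
  obtain ⟨R, hR⟩ := hK.bounded.subset_closedBall 0
  obtain ⟨ε, hε, hεK⟩ := Metric.nhds_basis_closedBall.mem_iff.1
    (mem_interior_iff_mem_nhds.1 hK.zero_mem_interior)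
  refine ⟨convex_convexHull ℝ _, ?_, ?_⟩
  · refine isBounded_convexHull.2 ((Metric.isBounded_closedBall (x := 0) (r := R ^ s)).subset ?_)
    intro x hx
    rw [mem_closedBall_zero_iff]
    have hR0 : 0 ≤ R := by simpa using hR hK.zero_mem
    by_cases hx0 : x = 0
    · rw [hx0, norm_zero]
      positivity
    · refine (hx.resolve_left hx0).trans (Real.rpow_le_rpow (radialFun_nonneg _ _) ?_ hs.le)
      exact csSup_le ⟨0, le_rfl, by simpa using hK.zero_mem⟩
        (bddAbove_radial hR (norm_inv_smul_self hx0))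
  · rw [mem_interior_iff_mem_nhds]
    refine Filter.mem_of_superset (Metric.closedBall_mem_nhds 0 (Real.rpow_pos_of_pos hε s)) ?_
    refine Subset.trans (fun x hx => ?_) (subset_convexHull ℝ _)
    by_cases hx0 : x = 0
    · exact Or.inl hx0
    · refine Or.inr ((mem_closedBall_zero_iff.1 hx).trans (Real.rpow_le_rpow hε.le ?_ hs.le))
      refine le_radialFun hK.bounded (norm_inv_smul_self hx0) hε.le (hεK ?_)
      rw [mem_closedBall_zero_iff, norm_smul, norm_inv_smul_self hx0, mul_one,
        Real.norm_of_nonneg hε.le]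

theorem naivePower_mono (hK : IsBodyAroundZero K) (hL : IsBodyAroundZero L) (hKL : K ⊆ L)
    (hs : 0 < s) : naivePower s K ⊆ naivePower s L := by
  refine convexHull_mono fun x hx => ?_
  by_cases hx0 : x = 0
  · exact Or.inl hx0
  · exact Or.inr ((hx.resolve_left hx0).trans (Real.rpow_le_rpow (radialFun_nonneg _ _)
      (radialFun_mono hK.zero_mem hKL hL.bounded (norm_inv_smul_self hx0)) hs.le))

theorem rpow_radialFun_le_radialFun_naivePower (hK : IsBodyAroundZero K) (hs : 0 < s)
    {θ : EuclideanSpace ℝ (Fin n)} (hθ : ‖θ‖ = 1) :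
    radialFun K θ ^ s ≤ radialFun (naivePower s K) θ := by
  have h0 : 0 ≤ radialFun K θ ^ s := Real.rpow_nonneg (radialFun_nonneg _ _) _
  refine le_radialFun (hK.naivePower hs).bounded hθ h0 (subset_convexHull ℝ _ ?_)
  obtain hr | hr := h0.eq_or_lt
  · exact Or.inl (by rw [← hr, zero_smul])
  · refine Or.inr ?_
    rw [norm_smul, hθ, mul_one, Real.norm_of_nonneg h0, smul_smul, inv_mul_cancel₀ hr.ne', one_smul]

/-- S_{rs}(K) is S_r applied to S_s(K), and taking the convex hull in between only increases the
radial function. This is why inserting a partition point enlarges the power. -/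
theorem naivePower_mul_subset (hK : IsBodyAroundZero K) {r : ℝ} (hr : 0 < r) (hs : 0 < s) :
    naivePower (r * s) K ⊆ naivePower r (naivePower s K) := by
  refine convexHull_mono fun x hx => ?_
  by_cases hx0 : x = 0
  · exact Or.inl hx0
  · refine Or.inr ((hx.resolve_left hx0).trans ?_)
    beta_reduce
    rw [mul_comm, Real.rpow_mul (radialFun_nonneg _ _)]
    exact Real.rpow_le_rpow (Real.rpow_nonneg (radialFun_nonneg _ _) _)
      (rpow_radialFun_le_radialFun_naivePower hK hs (norm_inv_smul_self hx0)) hr.le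

theorem volume_naivePower_le [NeZero n] (hK : IsBodyAroundZero K) (hs0 : 0 < s) (hs1 : s < 1) :
    volume (naivePower s K) ≤
      volume (Metric.closedBall (0 : EuclideanSpace ℝ (Fin n)) 1) ^ (1 - s) * volume K ^ s := by
  have hcl : volume (closure K) = volume K := by
    refine le_antisymm ?_ (measure_mono subset_closure)
    rw [closure_eq_self_union_frontier]
    refine (measure_union_le _ _).trans ?_
    rw [hK.convex.addHaar_frontier volume, add_zero]
  rw [← hcl]
  refine measure_convexHull_le volume (convex_closedBall 0 1) (by simp) hK.convex.closure
    (subset_closure hK.zero_mem) hs0 hs1 fun p hp hp0 => ?_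
  have hpos : 0 < ‖p‖ := norm_pos_iff.2 hp0
  -- The first multiple is the unit vector θ of p. The second is ‖p‖^(1/s) θ, which lies in the
  -- closure of K because ‖p‖ ≤ r_K(θ)^s. The powers of ‖p‖ cancel: -(1-s) + 1 - s = 0.
  refine ⟨‖p‖⁻¹, ‖p‖ ^ s⁻¹ * ‖p‖⁻¹, by positivity, by positivity, le_of_eq ?_, ?_, ?_⟩
  · rw [Real.mul_rpow (by positivity) (by positivity), ← Real.rpow_mul hpos.le,
      inv_mul_cancel₀ hs0.ne', Real.rpow_one, mul_left_comm, ← Real.rpow_add (by positivity),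
      sub_add_cancel, Real.rpow_one, mul_inv_cancel₀ hpos.ne']
  · rw [mem_closedBall_zero_iff, norm_inv_smul_self hp0]
  · rw [mul_smul]
    refine smul_mem_closure_of_le_radialFun hK.convex hK.bounded hK.zero_mem
      (norm_inv_smul_self hp0) (by positivity) ?_
    have := Real.rpow_le_rpow hpos.le (hp.resolve_left hp0) (inv_pos.2 hs0).le
    rwa [← Real.rpow_mul (radialFun_nonneg _ _), mul_inv_cancel₀ hs0.ne', Real.rpow_one] at this

end Power

/-! ### Partitions, refinement and iteration -/

section Partition

variable {n : ℕ}

theorem IsPartition.init {a b : ℝ} {m : ℕ} {t : ℕ → ℝ} (h : IsPartition a b (m + 1) t) :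
    IsPartition a (t m) m t :=
  ⟨h.1, rfl, fun i hi => h.2.2 i (by omega)⟩

theorem IsPartition.le {a b : ℝ} {m : ℕ} {t : ℕ → ℝ} (h : IsPartition a b m t) : a ≤ b := by
  induction m generalizing b with
  | zero => exact (h.1.symm.trans h.2.1).le
  | succ m ih => exact (ih h.init).trans ((h.2.2 m (by omega)).le.trans h.2.1.le)

theorem IsPartition.lt {a b : ℝ} {m : ℕ} {t : ℕ → ℝ} (h : IsPartition a b (m + 1) t) : a < b :=
  h.init.le.trans_lt ((h.2.2 m (by omega)).trans_le h.2.1.le)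

theorem IsPartition.append {a b c : ℝ} {m : ℕ} {t : ℕ → ℝ} (h : IsPartition a c m t)
    (hcb : c < b) : IsPartition a b (m + 1) (Function.update t (m + 1) b) := by
  refine ⟨by simpa using h.1, by simp, fun i hi => ?_⟩
  rw [Function.update_of_ne (by omega)]
  by_cases him : i = m
  · subst him
    simpa [h.2.1] using hcb
  · rw [Function.update_of_ne (by omega)]
    exact h.2.2 i (by omega)

theorem partitionPower_congr {m : ℕ} {t u : ℕ → ℝ} (h : ∀ i ≤ m, t i = u i)
    (K : Set (EuclideanSpace ℝ (Fin n))) : partitionPower t m K = partitionPower u m K := by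
  induction m generalizing K with
  | zero => rfl
  | succ m ih =>
    simp only [partitionPower]
    rw [ih (fun i hi => h i (by omega)), h m (by omega), h (m + 1) le_rfl]

theorem partitionPower_append {m : ℕ} (t : ℕ → ℝ) (b : ℝ) (K : Set (EuclideanSpace ℝ (Fin n))) :
    partitionPower (Function.update t (m + 1) b) (m + 1) K =
      partitionPower t m (naivePower (t m / b) K) := by
  simp only [partitionPower, Function.update_self]
  rw [Function.update_of_ne (by omega)]
  exact partitionPower_congr (fun i hi => Function.update_of_ne (by omega) _ _) _

theorem IsPartition.partitionPower_isBody {a b : ℝ} (ha : 0 < a) {m : ℕ} {t : ℕ → ℝ}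
    (h : IsPartition a b m t) {K : Set (EuclideanSpace ℝ (Fin n))} (hK : IsBodyAroundZero K) :
    IsBodyAroundZero (partitionPower t m K) := by
  induction m generalizing b K with
  | zero => exact hK
  | succ m ih =>
    have h1 := ha.trans_le h.init.le
    exact ih h.init (hK.naivePower (div_pos h1 (h1.trans (h.2.2 m (by omega)))))

theorem IsPartition.partitionPower_mono {a b : ℝ} (ha : 0 < a) {m : ℕ} {t : ℕ → ℝ}
    (h : IsPartition a b m t) {K L : Set (EuclideanSpace ℝ (Fin n))} (hK : IsBodyAroundZero K)
    (hL : IsBodyAroundZero L) (hKL : K ⊆ L) : partitionPower t m K ⊆ partitionPower t m L := by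
  induction m generalizing b K L with
  | zero => exact hKL
  | succ m ih =>
    have h1 := ha.trans_le h.init.le
    have h2 := div_pos h1 (h1.trans (h.2.2 m (by omega)))
    exact ih h.init (hK.naivePower h2) (hL.naivePower h2) (naivePower_mono hK hL hKL h2)

/-- Two partitions of the same interval have a common refinement, whose power is larger. -/
theorem IsPartition.exists_refinement {a b : ℝ} (ha : 0 < a) {m m' : ℕ} {t t' : ℕ → ℝ}
    (h : IsPartition a b m t) (h' : IsPartition a b m' t') :
    ∃ (k : ℕ) (u : ℕ → ℝ), IsPartition a b k u ∧
      ∀ K : Set (EuclideanSpace ℝ (Fin n)), IsBodyAroundZero K →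
        partitionPower t m K ⊆ partitionPower u k K ∧
          partitionPower t' m' K ⊆ partitionPower u k K := by
  induction hN : m + m' using Nat.strong_induction_on generalizing b m m' t t' with
  | _ N ih =>
    -- By symmetry, the last node of t' before b may be taken to be at most that of t.
    wlog hle : m' = 0 ∨ ∃ k k', m = k + 1 ∧ m' = k' + 1 ∧ t' k' ≤ t k generalizing m m' t t'
    · obtain ⟨k, u, hu, hsub⟩ := this h' h (by omega) (by
        rcases m with _ | m
        · exact Or.inl rfl
        rcases m' with _ | m'
        · exact absurd (Or.inl rfl) hle
        · refine Or.inr ⟨m', m, rfl, rfl, le_of_not_ge fun hc => hle (Or.inr ⟨m, m', rfl, rfl, hc⟩)⟩)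
      exact ⟨k, u, hu, fun K hK => (hsub K hK).symm⟩
    rcases hle with rfl | ⟨k, k', rfl, rfl, hle⟩
    · rcases m with _ | m
      · exact ⟨0, t, h, fun K _ => ⟨Subset.rfl, Subset.rfl⟩⟩
      · exact absurd (h'.1.symm.trans h'.2.1) h.lt.ne
    have hkb : t k < b := (h.2.2 k (by omega)).trans_le h.2.1.le
    have hk0 : 0 < t k := ha.trans_le h.init.le
    have hk0' : 0 < t' k' := ha.trans_le h'.init.le
    have hb0 : 0 < b := hk0.trans hkb
    have hs := div_pos hk0 hb0
    have hpow : ∀ K : Set (EuclideanSpace ℝ (Fin n)),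
        partitionPower t (k + 1) K = partitionPower t k (naivePower (t k / b) K) := fun K => by
      simp only [partitionPower, h.2.1]
    have hpow' : ∀ K : Set (EuclideanSpace ℝ (Fin n)),
        partitionPower t' (k' + 1) K = partitionPower t' k' (naivePower (t' k' / b) K) := fun K => by
      simp only [partitionPower, h'.2.1]
    rcases hle.eq_or_lt with heq | hlt
    · obtain ⟨j, u, hu, hsub⟩ := ih _ (by omega) h.init (heq ▸ h'.init) rfl
      refine ⟨j + 1, _, hu.append hkb, fun K hK => ?_⟩
      rw [partitionPower_append, hu.2.1, hpow, hpow', heq]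
      exact hsub _ (hK.naivePower hs)
    -- Compare on [a, t k]: append t k to the initial part of t'. Only t loses an interval in total,
    -- so the induction measure drops by one. The step from t' k' to b then splits at t k, which
    -- enlarges the power by `naivePower_mul_subset`.
    · obtain ⟨j, u, hu, hsub⟩ := ih _ (by omega) h.init (h'.init.append hlt) rfl
      refine ⟨j + 1, _, hu.append hkb, fun K hK => ?_⟩
      have hKs := hK.naivePower hs
      rw [partitionPower_append, hu.2.1, hpow, hpow']
      refine ⟨(hsub _ hKs).1, Subset.trans ?_ (hsub _ hKs).2⟩
      rw [partitionPower_append]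
      have hs' := div_pos hk0' hk0
      refine h'.init.partitionPower_mono ha (hK.naivePower (div_pos hk0' hb0))
        (hKs.naivePower hs') ?_
      have := naivePower_mul_subset hK hs' hs
      rwa [div_mul_div_cancel₀ hk0.ne'] at this

/-- With c the last node before b, the exponents of |K| multiply as (c/b)(a/c) = a/b, and those of
the ball add up: (1 - a/c) + (1 - c/b)(a/c) = 1 - a/b. -/
theorem IsPartition.volume_partitionPower_le [NeZero n] {a b : ℝ} (ha : 0 < a) {m : ℕ} {t : ℕ → ℝ}
    (h : IsPartition a b m t) {K : Set (EuclideanSpace ℝ (Fin n))} (hK : IsBodyAroundZero K) :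
    volume (partitionPower t m K) ≤
      volume (Metric.closedBall (0 : EuclideanSpace ℝ (Fin n)) 1) ^ (1 - a / b) *
        volume K ^ (a / b) := by
  induction m generalizing b K with
  | zero =>
    have hab : a = b := h.1.symm.trans h.2.1
    subst hab
    simp [partitionPower, div_self ha.ne']
  | succ m ih =>
    set c := t m
    have hac : a ≤ c := h.init.le
    have hcb : c < b := (h.2.2 m (by omega)).trans_le h.2.1.le
    have hc0 : 0 < c := ha.trans_le hac
    have hb0 : 0 < b := hc0.trans hcb
    have h1 : c / b < 1 := (div_lt_one hb0).2 hcb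
    have h2 : a / c ≤ 1 := (div_le_one hc0).2 hac
    have h3 : a / b = c / b * (a / c) := by field_simp
    have hstep := volume_naivePower_le hK (div_pos hc0 hb0) h1
    have := ih h.init (hK.naivePower (div_pos hc0 hb0))
    simp only [partitionPower, h.2.1]
    have ha0 : 0 ≤ a / c := by positivity
    calc _ ≤ _ := this
      _ ≤ volume (Metric.closedBall (0 : EuclideanSpace ℝ (Fin n)) 1) ^ (1 - a / c) *
          (volume (Metric.closedBall (0 : EuclideanSpace ℝ (Fin n)) 1) ^ (1 - c / b) *
            volume K ^ (c / b)) ^ (a / c) := by gcongr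
      _ = _ := by
        rw [ENNReal.mul_rpow_of_nonneg _ _ ha0, ← ENNReal.rpow_mul, ← ENNReal.rpow_mul, ← mul_assoc,
          ← ENNReal.rpow_add_of_nonneg _ _ (by linarith) (mul_nonneg (by linarith) ha0), h3]
        congr 2
        ring

end Partition

theorem mainTheorem4 (n : ℕ) (K : ConvexBody (EuclideanSpace ℝ (Fin n)))
    (hK : (0 : EuclideanSpace ℝ (Fin n)) ∈ interior (K : Set (EuclideanSpace ℝ (Fin n))))
    (lam : ℝ) (hlam0 : 0 < lam) (hlam1 : lam < 1) :
    volume (bodyPower (K : Set (EuclideanSpace ℝ (Fin n))) lam) ≤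
      volume (Metric.closedBall (0 : EuclideanSpace ℝ (Fin n)) 1) ^ (1 - lam) *
        volume (K : Set (EuclideanSpace ℝ (Fin n))) ^ lam := by
  have hB : IsBodyAroundZero (K : Set (EuclideanSpace ℝ (Fin n))) :=
    ⟨K.convex, K.isBounded, hK⟩
  -- The facet argument requires a nontrivial space; in dimension 0 both the ball and K are the
  -- whole space.
  rcases Nat.eq_zero_or_pos n with rfl | hn
  · have h1 : Metric.closedBall (0 : EuclideanSpace ℝ (Fin 0)) 1 = univ :=
      Subsingleton.eq_univ_of_nonempty ⟨0, by simp⟩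
    have h2 : (K : Set (EuclideanSpace ℝ (Fin 0))) = univ :=
      Subsingleton.eq_univ_of_nonempty K.nonempty
    rw [h1, h2, ← ENNReal.rpow_add_of_nonneg _ _ (by linarith) hlam0.le, sub_add_cancel,
      ENNReal.rpow_one]
    exact measure_mono (subset_univ _)
  have : NeZero n := ⟨hn.ne'⟩
  have hU : bodyPower (K : Set (EuclideanSpace ℝ (Fin n))) lam =
      closure (⋃ p : {p : ℕ × (ℕ → ℝ) // IsPartition lam 1 p.1 p.2},
        partitionPower p.1.2 p.1.1 (K : Set (EuclideanSpace ℝ (Fin n)))) := by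
    rw [bodyPower]
    congr 1
    ext x
    simp
  rw [hU]
  refine measure_closure_iUnion_le_of_directed volume
    (fun p => (p.2.partitionPower_isBody hlam0 hB).convex) (fun p q => ?_) fun p => ?_
  · obtain ⟨k, u, hu, hsub⟩ := p.2.exists_refinement (n := n) hlam0 q.2
    exact ⟨⟨(k, u), hu⟩, hsub _ hB⟩
  · simpa using p.2.volume_partitionPower_le hlam0 hB
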